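/- Let $A,C\in\mathbb R^{n\times n}$, $B,D\in\mathbb R^{n\times m}$, and let $Q\in\mathbb R^{n\times n}$, $R\in\mathbb R^{m\times m}$ be symmetric. Let $(w_k)_{k\ge 0}$ be independent real random variables on a probability space with $\mathbb E\,w_k=0$ and $\mathbb E(w_kw_s)=\delta_{ks}$. For $M,N\in\mathbb R^{n\times n}$ say that $[M;N]$ is asymptotically mean-square stable (ASMS) if for every deterministic $x_0\in\mathbb R^n$ the solution of $x_{k+1}=Mx_k+Nx_kw_k$ satisfies $\lim_{k\to\infty}\mathbb E\|x_k\|^2=0$. A gain $F\in\mathbb R^{m\times n}$ is called stabilizing if $[A+BF;\,C+DF]$ is ASMS. Assume: 1. $Q\succeq 0$ and $R\succ 0$; 2. a stabilizing gain exists; 3. $(A,C|Q)$ is exactly observable or exactly detectable. That is, there is an integer $T\ge 1$ such that, for every $x_0\in\mathbb R^n$, if the solution of $x_{k+1}=Ax_k+Cx_kw_k$ satisfies $Qx_k=0$ almost surely for all $0\le k\le T$, then $x_0=0$ (exact observability), respectively $\lim_{k\to\infty}\mathbb E\|x_k\|^2=0$ (exact detectability). Let $F^{(0)}$ be any stabilizing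 gain and, for $i=0,1,2,\dots$, let $P^{(i)}$ be the symmetric solution of the generalized Lyapunov equation $$P^{(i)}=(A+BF^{(i)})'P^{(i)}(A+BF^{(i)})+(C+DF^{(i)})'P^{(i)}(C+DF^{(i)})+Q+(F^{(i)})'RF^{(i)},$$ and put $$F^{(i+1)}=-\left(R+B'P^{(i)}B+D'P^{(i)}D\right)^{-1}\left(B'P^{(i)}A+D'P^{(i)}C\right).$$ Then the generalized algebraic Riccati equation $$A'PA+C'PC+Q-(A'PB+C'PD)(R+B'PB+D'PD)^{-1}(B'PA+D'PC)=P$$ has a unique solution $P^*\succeq 0$. Put $F^*=-(R+B'P^*B+D'P^*D)^{-1}(B'P^*A+D'P^*C)$. The following hold. * The iteration is well defined: for every $i$ the Lyapunov equation has exactly one symmetric solution $P^{(i)}$, it satisfies $P^{(i)}\succeq 0$, and $R+B'P^{(i)}B+D'P^{(i)}D\succ 0$. Every $F^{(i)}$ is stabilizing. If $(A,C|Q)$ is exactly observable, then moreover $P^{(i)}\succ 0$ for all $i$ and $P^*\succ 0$. * $P^*\preceq P^{(i+1)}\preceq P^{(i)}$ for all $i\ge 0$. * $\lim_{i\to\infty}P^{(i)}=P^*$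 and $\lim_{i\to\infty}F^{(i)}=F^*$. -/

import Mathlib

open MeasureTheory ProbabilityTheory Filter Topology
open scoped Matrix

noncomputable section

namespace SLQR

variable {Ω : Type*} [MeasurableSpace Ω] {n m : ℕ}

/-- The driving noise: independent real random variables with `E w_k = 0` and
`E (w_k w_s) = δ_{ks}`; no particular distribution is prescribed. -/
structure IsNoise (μ : Measure Ω) (w : ℕ → Ω → ℝ) : Prop where
  measurable : ∀ k, Measurable (w k)
  indep : iIndepFun w μ
  memLp : ∀ k, MemLp (w k) 2 μ
  mean_zero : ∀ k, ∫ ω, w k ω ∂μ = 0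
  covariance : ∀ k s, ∫ ω, w k ω * w s ω ∂μ = if k = s then 1 else 0

/-- The solution of `x_{k+1} = A x_k + C x_k w_k`, `x_0 = z`. -/
def state (w : ℕ → Ω → ℝ) (A C : Matrix (Fin n) (Fin n) ℝ) (z : Fin n → ℝ) :
    ℕ → Ω → (Fin n → ℝ)
  | 0, _ => z
  | k + 1, ω => A *ᵥ state w A C z k ω + w k ω • (C *ᵥ state w A C z k ω)

/-- `[A; C]` is asymptotically mean-square stable: `E (x_k' x_k) → 0` for every initial state. -/
def IsASMS (μ : Measure Ω) (w : ℕ → Ω → ℝ) (A C : Matrix (Fin n) (Fin n) ℝ) : Prop :=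
  ∀ z : Fin n → ℝ,
    Tendsto (fun k => ∫ ω, state w A C z k ω ⬝ᵥ state w A C z k ω ∂μ) atTop (𝓝 0)

/-- `F` is a stabilizing state-feedback gain: the closed loop
`x_{k+1} = (A + B F) x_k + (C + D F) x_k w_k` is asymptotically mean-square stable. -/
def IsStabilizing (μ : Measure Ω) (w : ℕ → Ω → ℝ) (A C : Matrix (Fin n) (Fin n) ℝ)
    (B D : Matrix (Fin n) (Fin m) ℝ) (F : Matrix (Fin m) (Fin n) ℝ) : Prop :=
  IsASMS μ w (A + B * F) (C + D * F)

/-- `[A, B; C, D]` is stabilizable. -/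
def Stabilizable (μ : Measure Ω) (w : ℕ → Ω → ℝ) (A C : Matrix (Fin n) (Fin n) ℝ)
    (B D : Matrix (Fin n) (Fin m) ℝ) : Prop :=
  ∃ F : Matrix (Fin m) (Fin n) ℝ, IsStabilizing μ w A C B D F

/-- `(A, C | Q)` is exactly observable: for some `T ≥ 1`, if the output `y_k = Q x_k` vanishes
almost surely for `k = 0, …, T`, then the initial state is zero. -/
def ExactlyObservable (μ : Measure Ω) (w : ℕ → Ω → ℝ)
    (A C Q : Matrix (Fin n) (Fin n) ℝ) : Prop :=
  ∃ T : ℕ, 1 ≤ T ∧ ∀ z : Fin n → ℝ,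
    (∀ k ≤ T, ∀ᵐ ω ∂μ, Q *ᵥ state w A C z k ω = 0) → z = 0

/-- `(A, C | Q)` is exactly detectable: for some `T ≥ 1`, if the output `y_k = Q x_k` vanishes
almost surely for `k = 0, …, T`, then `E ‖x_k‖² → 0`. -/
def ExactlyDetectable (μ : Measure Ω) (w : ℕ → Ω → ℝ)
    (A C Q : Matrix (Fin n) (Fin n) ℝ) : Prop :=
  ∃ T : ℕ, 1 ≤ T ∧ ∀ z : Fin n → ℝ,
    (∀ k ≤ T, ∀ᵐ ω ∂μ, Q *ᵥ state w A C z k ω = 0) →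
      Tendsto (fun k => ∫ ω, state w A C z k ω ⬝ᵥ state w A C z k ω ∂μ) atTop (𝓝 0)

/-- The standing assumption of the stochastic linear quadratic problem. -/
structure StandingAssumption (μ : Measure Ω) (w : ℕ → Ω → ℝ)
    (A C : Matrix (Fin n) (Fin n) ℝ) (B D : Matrix (Fin n) (Fin m) ℝ)
    (Q : Matrix (Fin n) (Fin n) ℝ) (R : Matrix (Fin m) (Fin m) ℝ) : Prop where
  posSemidef_Q : Q.PosSemidef
  posDef_R : R.PosDef
  stabilizable : Stabilizable μ w A C B D
  observable_or_detectable : ExactlyObservable μ w A C Q ∨ ExactlyDetectable μ w A C Q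

/-- The matrix `R + B'PB + D'PD`. -/
def weight (B D : Matrix (Fin n) (Fin m) ℝ) (R : Matrix (Fin m) (Fin m) ℝ)
    (P : Matrix (Fin n) (Fin n) ℝ) : Matrix (Fin m) (Fin m) ℝ :=
  R + Bᵀ * P * B + Dᵀ * P * D

/-- The gain `-(R + B'PB + D'PD)⁻¹ (B'PA + D'PC)` associated with `P`. -/
def gain (A C : Matrix (Fin n) (Fin n) ℝ) (B D : Matrix (Fin n) (Fin m) ℝ)
    (R : Matrix (Fin m) (Fin m) ℝ) (P : Matrix (Fin n) (Fin n) ℝ) : Matrix (Fin m) (Fin n) ℝ :=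
  -((weight B D R P)⁻¹ * (Bᵀ * P * A + Dᵀ * P * C))

/-- `P` solves the generalized algebraic Riccati equation (GARE). -/
def SolvesGARE (A C : Matrix (Fin n) (Fin n) ℝ) (B D : Matrix (Fin n) (Fin m) ℝ)
    (Q : Matrix (Fin n) (Fin n) ℝ) (R : Matrix (Fin m) (Fin m) ℝ)
    (P : Matrix (Fin n) (Fin n) ℝ) : Prop :=
  Aᵀ * P * A + Cᵀ * P * C + Q
    - (Aᵀ * P * B + Cᵀ * P * D) * (weight B D R P)⁻¹ * (Bᵀ * P * A + Dᵀ * P * C) = P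

/-- `P` solves the generalized Lyapunov equation evaluating the policy `F`. -/
def SolvesEvaluation (A C : Matrix (Fin n) (Fin n) ℝ) (B D : Matrix (Fin n) (Fin m) ℝ)
    (Q : Matrix (Fin n) (Fin n) ℝ) (R : Matrix (Fin m) (Fin m) ℝ)
    (F : Matrix (Fin m) (Fin n) ℝ) (P : Matrix (Fin n) (Fin n) ℝ) : Prop :=
  P = (A + B * F)ᵀ * P * (A + B * F) + (C + D * F)ᵀ * P * (C + D * F) + Q + Fᵀ * R * F

/-- `(P i), (F i)` is a run of the off-line policy iteration started at the gain `F₀`. -/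
structure IsPolicyIteration (A C : Matrix (Fin n) (Fin n) ℝ) (B D : Matrix (Fin n) (Fin m) ℝ)
    (Q : Matrix (Fin n) (Fin n) ℝ) (R : Matrix (Fin m) (Fin m) ℝ)
    (F₀ : Matrix (Fin m) (Fin n) ℝ)
    (P : ℕ → Matrix (Fin n) (Fin n) ℝ) (F : ℕ → Matrix (Fin m) (Fin n) ℝ) : Prop where
  init : F 0 = F₀
  symm : ∀ i, (P i).IsSymm
  evaluation : ∀ i, SolvesEvaluation A C B D Q R (F i) (P i)
  update : ∀ i, F (i + 1) = gain A C B D R (P i)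

end SLQR

end

/-! Write L for `lyap M N`. Independence, zero mean and unit variance of the noise give E x_k'Gx_k =
z'(L^k G)z (`IsNoise.integral_quad_state`), which removes probability: mean-square stability says
that the forms of L^k 1 tend to zero, and either hypothesis on (A, C | Q) yields `DetectableForm`.
For a stable pair, X = LX + W with W symmetric has exactly one symmetric solution, and W ⪰ 0 forces
X ⪰ 0; this is the comparison principle behind every inequality.

Let G be the `gain` at P. Completing the square (`lyap_closedLoop_eq`) shows that the right-hand
side of the evaluation equation at F exceeds the one at G by (F - G)' `weight` (F - G) ⪰ 0. Hence
the cost P of F solves the Lyapunov equation at G with an extra nonnegative source. This makes G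
stabilizing, and comparison puts the cost of G below P. The same identity at a Riccati solution X ⪰
0 puts X below the cost of every stabilizing gain. The costs therefore decrease to a limit, which
solves the Riccati equation by continuity. A positive semidefinite Riccati solution is the cost of
its own gain, which is stabilizing, so two of them bound each other and coincide.

The hard point is `meanSquareStable_of_detectable`. If P = LP + W, the iterates L^k P decrease to a
fixed point of L; subtracting it leaves H ⪰ 0 with H = LH + W and L^k H → 0. On ker H the forms of
all L^k W vanish, so detectability makes L^k 1 decay there, and some K ≥ 1 satisfies L^K 1 ≤ 1/2 +
cH everywhere. Applying L^j gives a contraction up to an error that tends to zero. -/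

namespace SLQR

section Lyapunov

variable {n : ℕ}

/-! ### Quadratic forms -/

/-- The quadratic form `z ↦ z' X z`. -/
def quad (X : Matrix (Fin n) (Fin n) ℝ) (z : Fin n → ℝ) : ℝ := z ⬝ᵥ X *ᵥ z

lemma quad_add (X Y : Matrix (Fin n) (Fin n) ℝ) (z : Fin n → ℝ) :
    quad (X + Y) z = quad X z + quad Y z := by
  simp [quad, Matrix.add_mulVec]

lemma quad_sub (X Y : Matrix (Fin n) (Fin n) ℝ) (z : Fin n → ℝ) :
    quad (X - Y) z = quad X z - quad Y z := by
  simp [quad, Matrix.sub_mulVec]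

lemma quad_smul (c : ℝ) (X : Matrix (Fin n) (Fin n) ℝ) (z : Fin n → ℝ) :
    quad (c • X) z = c * quad X z := by
  simp [quad, Matrix.smul_mulVec]

lemma quad_smul_vec (c : ℝ) (X : Matrix (Fin n) (Fin n) ℝ) (z : Fin n → ℝ) :
    quad X (c • z) = c ^ 2 * quad X z := by
  simp [quad, Matrix.mulVec_smul]; ring

lemma quad_one (z : Fin n → ℝ) : quad 1 z = z ⬝ᵥ z := by simp [quad]

lemma quad_conj {p : ℕ} (X : Matrix (Fin n) (Fin n) ℝ) (M : Matrix (Fin n) (Fin p) ℝ)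
    (z : Fin p → ℝ) : quad (Mᵀ * X * M) z = quad X (M *ᵥ z) := by
  simp only [quad]
  rw [Matrix.mul_assoc, ← Matrix.mulVec_mulVec, Matrix.dotProduct_mulVec, Matrix.vecMul_transpose,
    ← Matrix.mulVec_mulVec]

lemma continuous_quad (X : Matrix (Fin n) (Fin n) ℝ) : Continuous (quad X) := by
  unfold quad; fun_prop

lemma continuous_quad_left (z : Fin n → ℝ) :
    Continuous fun X : Matrix (Fin n) (Fin n) ℝ => quad X z := by
  unfold quad; fun_prop

lemma posSemidef_iff {X : Matrix (Fin n) (Fin n) ℝ} :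
    X.PosSemidef ↔ X.IsSymm ∧ ∀ z, 0 ≤ quad X z :=
  ⟨fun h => ⟨Matrix.isHermitian_iff_isSymm.1 h.1, fun z => h.dotProduct_mulVec_nonneg z⟩,
    fun h => .of_dotProduct_mulVec_nonneg (Matrix.isHermitian_iff_isSymm.2 h.1) h.2⟩

lemma quad_nonneg {X : Matrix (Fin n) (Fin n) ℝ} (h : X.PosSemidef) (z : Fin n → ℝ) :
    0 ≤ quad X z := (posSemidef_iff.1 h).2 z

lemma isSymm_of_posSemidef {X : Matrix (Fin n) (Fin n) ℝ} (h : X.PosSemidef) : X.IsSymm :=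
  (posSemidef_iff.1 h).1

lemma quad_eq_zero_iff {X : Matrix (Fin n) (Fin n) ℝ} (h : X.PosSemidef) {z : Fin n → ℝ} :
    quad X z = 0 ↔ X *ᵥ z = 0 := h.dotProduct_mulVec_zero_iff z

lemma posDef_of_quad_eq_zero {X : Matrix (Fin n) (Fin n) ℝ} (h : X.PosSemidef)
    (h0 : ∀ z, quad X z = 0 → z = 0) : X.PosDef :=
  .of_dotProduct_mulVec_pos h.1 fun z hz =>
    lt_of_le_of_ne (quad_nonneg h z) fun e => hz (h0 z e.symm)

lemma quad_one_pos {z : Fin n → ℝ} (hz : z ≠ 0) : 0 < quad 1 z :=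
  Matrix.PosDef.one.dotProduct_mulVec_pos hz

/-- Polarization. -/
lemma entry_eq_quad {X : Matrix (Fin n) (Fin n) ℝ} (h : X.IsSymm) (i j : Fin n) :
    X i j = (quad X (Pi.single i 1 + Pi.single j 1) - quad X (Pi.single i 1)
      - quad X (Pi.single j 1)) / 2 := by
  simp [quad, Matrix.mulVec_add, h.apply i j]
  ring

lemma eq_of_quad {X Y : Matrix (Fin n) (Fin n) ℝ} (hX : X.IsSymm) (hY : Y.IsSymm)
    (h : ∀ z, quad X z = quad Y z) : X = Y := by
  ext i j
  rw [entry_eq_quad hX, entry_eq_quad hY]; simp only [h]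

/-- Follows from |z_i||z_j| ≤ (z_i² + z_j²)/2. It dominates every form by a multiple of the
identity, so decay of L^k 1 controls L^k X for all X. -/
lemma abs_quad_le (X : Matrix (Fin n) (Fin n) ℝ) (z : Fin n → ℝ) :
    |quad X z| ≤ (∑ i, ∑ j, |X i j|) * quad 1 z := by
  have hz : ∀ i, z i * z i ≤ quad 1 z := fun i => by
    rw [quad_one]
    exact Finset.single_le_sum (f := fun i => z i * z i) (fun i _ => mul_self_nonneg _)
      (Finset.mem_univ i)
  have e : quad X z = ∑ i, ∑ j, z i * (X i j * z j) := by
    simp [quad, dotProduct, Matrix.mulVec, Finset.mul_sum]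
  rw [e, Finset.sum_mul]
  refine (Finset.abs_sum_le_sum_abs _ _).trans (Finset.sum_le_sum fun i _ => ?_)
  rw [Finset.sum_mul]
  refine (Finset.abs_sum_le_sum_abs _ _).trans (Finset.sum_le_sum fun j _ => ?_)
  have : |z i * (X i j * z j)| = |X i j| * (|z i| * |z j|) := by
    simp only [abs_mul]; ring
  rw [this]
  refine mul_le_mul_of_nonneg_left ?_ (abs_nonneg _)
  have h1 := hz i
  have h2 := hz j
  rw [← abs_mul_abs_self] at h1 h2
  nlinarith [sq_nonneg (|z i| - |z j|)]

/-- Pointwise convergence of symmetric quadratic forms is convergence of the matrices. -/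
lemma tendsto_of_quad {X : ℕ → Matrix (Fin n) (Fin n) ℝ} {Y : Matrix (Fin n) (Fin n) ℝ}
    (hX : ∀ k, (X k).IsSymm) (hY : Y.IsSymm)
    (h : ∀ z, Tendsto (fun k => quad (X k) z) atTop (𝓝 (quad Y z))) :
    Tendsto X atTop (𝓝 Y) := by
  refine tendsto_pi_nhds.2 fun i => tendsto_pi_nhds.2 fun j => ?_
  rw [entry_eq_quad hY]
  simp only [fun k => entry_eq_quad (hX k) i j]
  exact (((h _).sub (h _)).sub (h _)).div_const 2

lemma isSymm_of_tendsto {X : ℕ → Matrix (Fin n) (Fin n) ℝ} {Y : Matrix (Fin n) (Fin n) ℝ}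
    (hX : ∀ k, (X k).IsSymm) (h : Tendsto X atTop (𝓝 Y)) : Y.IsSymm := by
  have h2 : Tendsto (fun k => (X k)ᵀ) atTop (𝓝 Yᵀ) :=
    (continuous_id.matrix_transpose.tendsto Y).comp h
  exact tendsto_nhds_unique (h2.congr fun k => hX k) h

lemma posSemidef_of_tendsto {X : ℕ → Matrix (Fin n) (Fin n) ℝ} {Y : Matrix (Fin n) (Fin n) ℝ}
    (hX : ∀ k, (X k).PosSemidef) (h : Tendsto X atTop (𝓝 Y)) : Y.PosSemidef :=
  posSemidef_iff.2 ⟨isSymm_of_tendsto (fun k => isSymm_of_posSemidef (hX k)) h, fun z =>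
    ge_of_tendsto' (((continuous_quad_left z).tendsto Y).comp h) fun k => quad_nonneg (hX k) z⟩

/-- A decreasing sequence of positive semidefinite matrices converges to a lower bound. -/
lemma exists_tendsto_of_antitone {X : ℕ → Matrix (Fin n) (Fin n) ℝ}
    (hX : ∀ k, (X k).PosSemidef) (hanti : ∀ k, (X k - X (k + 1)).PosSemidef) :
    ∃ Y, Y.PosSemidef ∧ Tendsto X atTop (𝓝 Y) ∧ ∀ k, (X k - Y).PosSemidef := by
  have anti : ∀ z, Antitone fun k => quad (X k) z := fun z => antitone_nat_of_succ_le fun k => by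
    have := quad_nonneg (hanti k) z
    rw [quad_sub] at this
    linarith
  have hconv : ∀ z, ∃ l, Tendsto (fun k => quad (X k) z) atTop (𝓝 l) := fun z =>
    ⟨_, tendsto_atTop_ciInf (anti z) ⟨0, by rintro _ ⟨k, rfl⟩; exact quad_nonneg (hX k) z⟩⟩
  choose l hl using hconv
  have hY : Tendsto X atTop (𝓝 (Matrix.of fun i j => (l (Pi.single i 1 + Pi.single j 1)
      - l (Pi.single i 1) - l (Pi.single j 1)) / 2)) := by
    refine tendsto_pi_nhds.2 fun i => tendsto_pi_nhds.2 fun j => ?_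
    simp only [fun k => entry_eq_quad (isSymm_of_posSemidef (hX k)) i j]
    exact (((hl _).sub (hl _)).sub (hl _)).div_const 2
  have hp := posSemidef_of_tendsto hX hY
  refine ⟨_, hp, hY, fun k => posSemidef_iff.2
    ⟨(isSymm_of_posSemidef (hX k)).sub (isSymm_of_posSemidef hp), fun z => ?_⟩⟩
  rw [quad_sub, sub_nonneg]
  exact (anti z).le_of_tendsto (((continuous_quad_left z).tendsto _).comp hY) k

/-! ### The generalized Lyapunov operator -/

/-- The generalized Lyapunov operator `X ↦ M' X M + N' X N`. -/
def lyap (M N : Matrix (Fin n) (Fin n) ℝ) :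
    Matrix (Fin n) (Fin n) ℝ →ₗ[ℝ] Matrix (Fin n) (Fin n) ℝ where
  toFun X := Mᵀ * X * M + Nᵀ * X * N
  map_add' X Y := by simp only [Matrix.mul_add, Matrix.add_mul]; abel
  map_smul' c X := by simp

lemma lyap_apply (M N X : Matrix (Fin n) (Fin n) ℝ) :
    lyap M N X = Mᵀ * X * M + Nᵀ * X * N := rfl

variable {M N : Matrix (Fin n) (Fin n) ℝ}

lemma quad_lyap (X : Matrix (Fin n) (Fin n) ℝ) (z : Fin n → ℝ) :
    quad (lyap M N X) z = quad X (M *ᵥ z) + quad X (N *ᵥ z) := by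
  rw [lyap_apply, quad_add, quad_conj, quad_conj]

lemma isSymm_lyap {X : Matrix (Fin n) (Fin n) ℝ} (h : X.IsSymm) : (lyap M N X).IsSymm := by
  simp [Matrix.IsSymm, lyap_apply, Matrix.mul_assoc, h.eq]

lemma lyap_pow_succ_apply (k : ℕ) (X : Matrix (Fin n) (Fin n) ℝ) :
    (lyap M N ^ (k + 1)) X = lyap M N ((lyap M N ^ k) X) := by
  rw [pow_succ', Module.End.mul_apply]

lemma lyap_pow_succ_apply' (k : ℕ) (X : Matrix (Fin n) (Fin n) ℝ) :
    (lyap M N ^ (k + 1)) X = (lyap M N ^ k) (lyap M N X) := by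
  rw [pow_succ, Module.End.mul_apply]

lemma quad_lyap_pow_succ (k : ℕ) (X : Matrix (Fin n) (Fin n) ℝ) (z : Fin n → ℝ) :
    quad ((lyap M N ^ (k + 1)) X) z =
      quad ((lyap M N ^ k) X) (M *ᵥ z) + quad ((lyap M N ^ k) X) (N *ᵥ z) := by
  rw [lyap_pow_succ_apply, quad_lyap]

lemma isSymm_lyap_pow {X : Matrix (Fin n) (Fin n) ℝ} (h : X.IsSymm) (k : ℕ) :
    ((lyap M N ^ k) X).IsSymm := by
  induction k with
  | zero => simpa
  | succ k ih => rw [lyap_pow_succ_apply]; exact isSymm_lyap ih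

/-- The form of LX at z is a sum of values of the form of X, at Mz and Nz, so L preserves the
pointwise order of forms, without any symmetry. -/
lemma quad_lyap_pow_mono {X Y : Matrix (Fin n) (Fin n) ℝ} (h : ∀ z, quad X z ≤ quad Y z) (k : ℕ)
    (z : Fin n → ℝ) : quad ((lyap M N ^ k) X) z ≤ quad ((lyap M N ^ k) Y) z := by
  induction k generalizing z with
  | zero => simpa using h z
  | succ k ih => simp only [quad_lyap_pow_succ]; exact add_le_add (ih _) (ih _)

lemma posSemidef_lyap_pow {X : Matrix (Fin n) (Fin n) ℝ} (h : X.PosSemidef) (k : ℕ) :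
    ((lyap M N ^ k) X).PosSemidef := by
  refine posSemidef_iff.2 ⟨isSymm_lyap_pow (isSymm_of_posSemidef h) k, fun z => ?_⟩
  have := quad_lyap_pow_mono (M := M) (N := N) (X := 0) (Y := X)
    (fun z => by simpa [quad] using quad_nonneg h z) k z
  simpa [quad] using this

/-- Deterministic form of mean-square stability of `[M; N]`. -/
def MeanSquareStable (M N : Matrix (Fin n) (Fin n) ℝ) : Prop :=
  ∀ z, Tendsto (fun k => quad ((lyap M N ^ k) 1) z) atTop (𝓝 0)

lemma MeanSquareStable.tendsto_quad (h : MeanSquareStable M N) (X : Matrix (Fin n) (Fin n) ℝ)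
    (z : Fin n → ℝ) : Tendsto (fun k => quad ((lyap M N ^ k) X) z) atTop (𝓝 0) := by
  set c := ∑ i, ∑ j, |X i j| with hc
  refine squeeze_zero_norm (a := fun k => c * quad ((lyap M N ^ k) 1) z) (fun k => ?_)
    (by simpa using (h z).const_mul c)
  have hb : ∀ z, quad X z ≤ quad (c • (1 : Matrix (Fin n) (Fin n) ℝ)) z ∧
      quad ((-c) • (1 : Matrix (Fin n) (Fin n) ℝ)) z ≤ quad X z := fun z => by
    have := abs_le.1 (abs_quad_le X z)
    rw [quad_smul, quad_smul]
    constructor <;> linarith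
  have h1 := quad_lyap_pow_mono (M := M) (N := N) (fun z => (hb z).1) k z
  have h2 := quad_lyap_pow_mono (M := M) (N := N) (fun z => (hb z).2) k z
  rw [map_smul, quad_smul] at h1 h2
  rw [Real.norm_eq_abs, abs_le]
  constructor <;> linarith

/-- A fixed point equals all its iterates, whose forms tend to zero; symmetry then recovers the
matrix from its form. -/
lemma MeanSquareStable.eq_zero (h : MeanSquareStable M N) {X : Matrix (Fin n) (Fin n) ℝ}
    (hX : X.IsSymm) (e : lyap M N X = X) : X = 0 := by
  have hk : ∀ k, (lyap M N ^ k) X = X := fun k => by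
    induction k with
    | zero => simp
    | succ k ih => rw [lyap_pow_succ_apply, ih, e]
  refine eq_of_quad hX (by simp [Matrix.IsSymm]) fun z => ?_
  have := h.tendsto_quad X z
  simp only [hk] at this
  rw [tendsto_nhds_unique tendsto_const_nhds this]; simp [quad]

lemma MeanSquareStable.unique (h : MeanSquareStable M N) {X Y W : Matrix (Fin n) (Fin n) ℝ}
    (hX : X.IsSymm) (hY : Y.IsSymm) (eX : X = lyap M N X + W) (eY : Y = lyap M N Y + W) :
    X = Y := by
  refine sub_eq_zero.1 (h.eq_zero (hX.sub hY) ?_)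
  rw [map_sub, eq_sub_of_add_eq eX.symm, eq_sub_of_add_eq eY.symm, sub_sub_sub_cancel_right]

/-- The Lyapunov equation of a stable pair is solvable. -/
lemma MeanSquareStable.exists_solution (h : MeanSquareStable M N) {W : Matrix (Fin n) (Fin n) ℝ}
    (hW : W.IsSymm) : ∃ X : Matrix (Fin n) (Fin n) ℝ, X.IsSymm ∧ X = lyap M N X + W := by
  -- Stability gives injectivity of id - L only on symmetric matrices, so the finite-dimensional
  -- injective-implies-surjective argument is run on that subspace.
  let S : Submodule ℝ (Matrix (Fin n) (Fin n) ℝ) :=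
    { carrier := {X | X.IsSymm}
      add_mem' := fun h1 h2 => h1.add h2
      zero_mem' := by simp [Matrix.IsSymm]
      smul_mem' := fun c X hX => hX.smul c }
  let f : S →ₗ[ℝ] S := (LinearMap.id - lyap M N).restrict
    (fun X hX => Matrix.IsSymm.sub (A := X) hX (isSymm_lyap hX))
  have hf : Function.Injective f := by
    refine (injective_iff_map_eq_zero f).2 fun X hX => ?_
    have e : X.1 - lyap M N X.1 = 0 := congrArg Subtype.val hX
    exact Subtype.ext (h.eq_zero X.2 (sub_eq_zero.1 e).symm)
  obtain ⟨X, hX⟩ := LinearMap.injective_iff_surjective.1 hf ⟨W, hW⟩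
  have e : X.1 - lyap M N X.1 = W := congrArg Subtype.val hX
  exact ⟨X.1, X.2, by rw [← e]; abel⟩

/-- Iterates of the Lyapunov operator decrease from a supersolution. -/
lemma quad_lyap_pow_succ_le {X W : Matrix (Fin n) (Fin n) ℝ} (hW : W.PosSemidef)
    (e : X = lyap M N X + W) (k : ℕ) (z : Fin n → ℝ) :
    quad ((lyap M N ^ (k + 1)) X) z ≤ quad ((lyap M N ^ k) X) z := by
  rw [lyap_pow_succ_apply']
  refine quad_lyap_pow_mono (fun z => ?_) k z
  nth_rewrite 2 [e]
  rw [quad_add]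
  linarith [quad_nonneg hW z]

/-- The forms of L^k X decrease in k and tend to zero, so the one at k = 0 is nonnegative. -/
lemma MeanSquareStable.posSemidef (h : MeanSquareStable M N) {X W : Matrix (Fin n) (Fin n) ℝ}
    (hX : X.IsSymm) (hW : W.PosSemidef) (e : X = lyap M N X + W) : X.PosSemidef := by
  refine posSemidef_iff.2 ⟨hX, fun z => ?_⟩
  have := (antitone_nat_of_succ_le (f := fun k => quad ((lyap M N ^ k) X) z)
    fun k => quad_lyap_pow_succ_le hW e k z).le_of_tendsto (h.tendsto_quad X z) 0
  simpa using this

/-! ### Detectability implies stability -/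

/-- A nonnegative sequence contracted along steps of length `K`, up to a vanishing error, tends
to zero. -/
lemma tendsto_zero_of_contraction {a e : ℕ → ℝ} {K : ℕ} (ha : ∀ j, 0 ≤ a j) (hK : 1 ≤ K)
    (h : ∀ j, a (j + K) ≤ a j / 2 + e j) (he : Tendsto e atTop (𝓝 0)) :
    Tendsto a atTop (𝓝 0) := by
  obtain ⟨b, hb⟩ := he.bddAbove_range
  have hb : ∀ j, e j ≤ b := fun j => hb ⟨j, rfl⟩
  -- The condition 2b ≤ B gives B/2 + b ≤ B, which closes the strong induction below.
  obtain ⟨B, hB0, hB⟩ : ∃ B, 2 * b ≤ B ∧ ∀ j < K, a j ≤ B := by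
    refine ⟨max (2 * b) (∑ j ∈ Finset.range K, a j), le_max_left _ _, fun j hj => ?_⟩
    exact (Finset.single_le_sum (fun j _ => ha j) (Finset.mem_range.2 hj)).trans (le_max_right _ _)
  have hbd : ∀ j, a j ≤ B := fun j => by
    induction j using Nat.strong_induction_on with
    | _ j ih =>
      by_cases hj : j < K
      · exact hB j hj
      · have h1 := h (j - K)
        rw [Nat.sub_add_cancel (not_lt.1 hj)] at h1
        have h2 := ih (j - K) (by omega)
        linarith [hb (j - K)]
  refine tendsto_order.2 ⟨fun l hl => .of_forall fun j => hl.trans_le (ha j), fun ε hε => ?_⟩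
  -- Once the error is below ε/4, a shift by K halves the excess over ε/2, the fixed point of t ↦
  -- t/2 + ε/4.
  have key : ∀ i : ℕ, ∀ᶠ j in atTop, a j ≤ B * (1 / 2) ^ i + ε / 2 := fun i => by
    induction i with
    | zero => exact .of_forall fun j => by simpa using (hbd j).trans (by linarith)
    | succ i ih =>
      rw [← Filter.map_add_atTop_eq_nat K, eventually_map]
      filter_upwards [ih, he.eventually_le_const (show (0 : ℝ) < ε / 4 by linarith)] with j h1 h2
      rw [pow_succ]
      linarith [h j]
  have hlim : Tendsto (fun i : ℕ => B * (1 / 2 : ℝ) ^ i + ε / 2) atTop (𝓝 (B * 0 + ε / 2)) :=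
    ((tendsto_pow_atTop_nhds_zero_of_lt_one (by norm_num) (by norm_num)).const_mul B).add_const _
  obtain ⟨i, hi⟩ := (hlim.eventually_lt_const (show B * 0 + ε / 2 < ε by linarith)).exists
  filter_upwards [key i] with j hj using hj.trans_lt hi

/-- A form which is strictly below `½ ‖z‖²` on the kernel of a positive semidefinite form `P` is
below `½ ‖z‖² + c P`. -/
lemma exists_quad_le_half_add {G P : Matrix (Fin n) (Fin n) ℝ} (hP : P.PosSemidef)
    (h : ∀ z ≠ 0, quad P z = 0 → quad G z < quad 1 z / 2) :
    ∃ c, ∀ z, quad G z ≤ quad 1 z / 2 + c * quad P z := by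
  -- The unit vectors where the bound without P is not strict. They form a compact set on which P is
  -- positive by `h`, hence bounded away from zero.
  let S : Set (Fin n → ℝ) := Metric.sphere 0 1 ∩ {z | quad 1 z / 2 ≤ quad G z}
  have hS : IsCompact S := (isCompact_sphere 0 1).inter_right
    (isClosed_le ((continuous_quad 1).div_const 2) (continuous_quad G))
  obtain ⟨c, hc0, hc⟩ : ∃ c, 0 ≤ c ∧ ∀ z ∈ S, quad G z - quad 1 z / 2 ≤ c * quad P z := by
    rcases S.eq_empty_or_nonempty with hS0 | hS0
    · exact ⟨0, le_rfl, by simp [hS0]⟩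
    obtain ⟨x, hx, hmin⟩ := hS.exists_isMinOn hS0 (continuous_quad P).continuousOn
    obtain ⟨y, hy, hmax⟩ := hS.exists_isMaxOn hS0
      ((continuous_quad G).sub ((continuous_quad 1).div_const 2)).continuousOn
    have hx0 : x ≠ 0 := by
      rintro rfl
      simpa using hx.1
    have hpos : 0 < quad P x := lt_of_le_of_ne (quad_nonneg hP x) fun e =>
      absurd (h x hx0 e.symm) (not_lt.2 hx.2)
    have hy2 : 0 ≤ quad G y - quad 1 y / 2 := sub_nonneg.2 hy.2
    -- The largest excess of G over half the identity on S, divided by the least value of P there.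
    refine ⟨(quad G y - quad 1 y / 2) / quad P x, by positivity, fun z hz => ?_⟩
    have h1 : quad G z - quad 1 z / 2 ≤ quad G y - quad 1 y / 2 := hmax hz
    have h2 : quad P x ≤ quad P z := hmin hz
    rw [div_mul_eq_mul_div, le_div_iff₀ hpos]
    exact mul_le_mul h1 h2 hpos.le hy2
  refine ⟨c, fun z => ?_⟩
  by_cases hz : z = 0
  · simp [hz, quad]
  have hn : 0 < ‖z‖ := norm_pos_iff.2 hz
  have hunit : quad G (‖z‖⁻¹ • z) - quad 1 (‖z‖⁻¹ • z) / 2 ≤ c * quad P (‖z‖⁻¹ • z) := by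
    by_cases hm : quad 1 (‖z‖⁻¹ • z) / 2 ≤ quad G (‖z‖⁻¹ • z)
    · exact hc _ ⟨by simp [norm_smul, hn.ne'], hm⟩
    · have := mul_nonneg hc0 (quad_nonneg hP (‖z‖⁻¹ • z))
      linarith
  simp only [quad_smul_vec] at hunit
  have hp : (0 : ℝ) < ‖z‖⁻¹ ^ 2 := by positivity
  refine le_of_mul_le_mul_left ?_ hp
  linarith

/-- If the quadratic forms of `G k` tend to zero on the kernel of `P`, then eventually they lie
below `½ ‖z‖²` there. -/
lemma eventually_quad_lt_half_on_ker {G : ℕ → Matrix (Fin n) (Fin n) ℝ}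
    {P : Matrix (Fin n) (Fin n) ℝ} (hG : ∀ k, (G k).IsSymm)
    (h : ∀ z, P *ᵥ z = 0 → Tendsto (fun k => quad (G k) z) atTop (𝓝 0)) :
    ∀ᶠ k in atTop, ∀ z ≠ 0, P *ᵥ z = 0 → quad (G k) z < quad 1 z / 2 := by
  let U := LinearMap.ker (Matrix.toLin' P)
  -- E is a projection onto ker P. The matrices E' G_k E tend to zero, which turns pointwise decay
  -- on the kernel into a bound uniform in z.
  obtain ⟨g, hg⟩ := LinearMap.exists_leftInverse_of_injective U.subtype (by simp)
  let E := LinearMap.toMatrix' (U.subtype ∘ₗ g)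
  have hE : ∀ z, E *ᵥ z = g z := fun z => by
    rw [← Matrix.toLin'_apply, Matrix.toLin'_toMatrix']; rfl
  have hEU : ∀ z, P *ᵥ (E *ᵥ z) = 0 := fun z => by
    rw [hE]; exact LinearMap.mem_ker.1 (g z).2
  have hEz : ∀ z, P *ᵥ z = 0 → E *ᵥ z = z := fun z hz => by
    rw [hE]
    have := LinearMap.congr_fun hg (⟨z, by simpa [U] using hz⟩ : U)
    exact congrArg Subtype.val this
  have hlim : Tendsto (fun k => Eᵀ * G k * E) atTop (𝓝 0) := by
    refine tendsto_of_quad (fun k => ?_) (by simp [Matrix.IsSymm]) fun z => ?_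
    · simp [Matrix.IsSymm, Matrix.mul_assoc, (hG k).eq]
    · simp only [quad_conj]
      simpa [quad] using h _ (hEU z)
  have hsum : Tendsto (fun k => ∑ i, ∑ j, |(Eᵀ * G k * E) i j|) atTop (𝓝 0) := by
    have : Continuous fun X : Matrix (Fin n) (Fin n) ℝ => ∑ i, ∑ j, |X i j| := by fun_prop
    simpa [Function.comp_def] using (this.tendsto 0).comp hlim
  filter_upwards [hsum.eventually_lt_const (show (0 : ℝ) < 1 / 2 by norm_num)] with k hk z hz hPz
  have h1 := (le_abs_self _).trans (abs_quad_le (Eᵀ * G k * E) z)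
  rw [quad_conj, hEz z hPz] at h1
  have := mul_lt_mul_of_pos_right hk (quad_one_pos hz)
  linarith

/-- A positive semidefinite solution of a Lyapunov equation with detectable right-hand side forces
mean-square stability. -/
theorem meanSquareStable_of_detectable {P W : Matrix (Fin n) (Fin n) ℝ} (hP : P.PosSemidef)
    (hW : W.PosSemidef) (e : P = lyap M N P + W)
    (hdet : ∀ z, (∀ k, quad ((lyap M N ^ k) W) z = 0) →
      Tendsto (fun k => quad ((lyap M N ^ k) 1) z) atTop (𝓝 0)) :
    MeanSquareStable M N := by
  have hstep : ∀ k, (lyap M N ^ k) P - (lyap M N ^ (k + 1)) P = (lyap M N ^ k) W := fun k => by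
    rw [lyap_pow_succ_apply', ← map_sub]
    congr 1
    nth_rewrite 1 [e]
    abel
  obtain ⟨L, hL, hlim, hle⟩ := exists_tendsto_of_antitone
    (X := fun k => (lyap M N ^ k) P) (fun k => posSemidef_lyap_pow hP k)
    (fun k => by rw [hstep]; exact posSemidef_lyap_pow hW k)
  have hfix : lyap M N L = L := by
    have hc : Continuous (lyap M N) := LinearMap.continuous_of_finiteDimensional _
    refine tendsto_nhds_unique ?_ ((tendsto_add_atTop_iff_nat 1).2 hlim)
    simpa only [lyap_pow_succ_apply, Function.comp_def] using (hc.tendsto L).comp hlim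
  have hfixk : ∀ k, (lyap M N ^ k) L = L := fun k => by
    induction k with
    | zero => simp
    | succ k ih => rw [lyap_pow_succ_apply, ih, hfix]
  have hH : (P - L).PosSemidef := by simpa using hle 0
  have hHlim : ∀ z, Tendsto (fun k => quad ((lyap M N ^ k) (P - L)) z) atTop (𝓝 0) := fun z => by
    have h1 := (((continuous_quad_left z).tendsto L).comp hlim).sub_const (quad L z)
    simpa only [map_sub, hfixk, quad_sub, sub_self, Function.comp_def] using h1
  have hHW : P - L = lyap M N (P - L) + W := by
    rw [map_sub, hfix]
    nth_rewrite 1 [e]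
    abel
  -- If H = P - L kills z, then the decreasing nonnegative forms of the iterates of H vanish at z,
  -- and by H = `lyap M N` H + W so do those of W.
  have hker : ∀ z, (P - L) *ᵥ z = 0 →
      Tendsto (fun k => quad ((lyap M N ^ k) 1) z) atTop (𝓝 0) := fun z hz => by
    have hzero : ∀ k, quad ((lyap M N ^ k) (P - L)) z = 0 := fun k => by
      refine le_antisymm ?_ (quad_nonneg (posSemidef_lyap_pow hH k) z)
      have := (antitone_nat_of_succ_le (f := fun k => quad ((lyap M N ^ k) (P - L)) z)
        fun k => quad_lyap_pow_succ_le hW hHW k z) (Nat.zero_le k)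
      simpa [(quad_eq_zero_iff hH).2 hz] using this
    refine hdet z fun k => ?_
    have h1 := hzero k
    rw [hHW, map_add, quad_add, ← lyap_pow_succ_apply', hzero (k + 1), zero_add] at h1
    exact h1
  obtain ⟨K, hK1, hK⟩ := ((eventually_ge_atTop 1).and (eventually_quad_lt_half_on_ker
    (fun k => isSymm_lyap_pow (M := M) (N := N) (X := 1) Matrix.isSymm_one k) hker)).exists
  obtain ⟨c, hc⟩ := exists_quad_le_half_add hH
    (fun z hz h0 => hK z hz ((quad_eq_zero_iff hH).1 h0))
  intro z
  refine tendsto_zero_of_contraction (e := fun j => c * quad ((lyap M N ^ j) (P - L)) z)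
    (fun j => quad_nonneg (posSemidef_lyap_pow .one j) z) hK1 (fun j => ?_)
    (by simpa using (hHlim z).const_mul c)
  have := quad_lyap_pow_mono (M := M) (N := N) (X := (lyap M N ^ K) 1)
    (Y := (1 / 2 : ℝ) • 1 + c • (P - L))
    (fun z => by rw [quad_add, quad_smul, quad_smul]; linarith [hc z]) j z
  rw [map_add, map_smul, map_smul, quad_add, quad_smul, quad_smul, ← Module.End.mul_apply,
    ← pow_add] at this
  linarith

end Lyapunov

/-! ### Second moments of the state -/

/-- The state at time k depends measurably on w_0, …, w_{k-1} only; its independence from w_k rests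
on this. -/
lemma exists_state_eq_comp {Ω : Type*} {n : ℕ} (w : ℕ → Ω → ℝ) (M N : Matrix (Fin n) (Fin n) ℝ) (z : Fin n → ℝ)
    (k : ℕ) : ∃ g : (Finset.range k → ℝ) → (Fin n → ℝ), Measurable g ∧
      ∀ ω, state w M N z k ω = g fun i => w i ω := by
  induction k with
  | zero => exact ⟨fun _ => z, measurable_const, fun ω => rfl⟩
  | succ k ih =>
    obtain ⟨g, hg, h⟩ := ih
    let r : (Finset.range (k + 1) → ℝ) → (Finset.range k → ℝ) := fun v i =>
      v ⟨i, Finset.range_subset_range.2 k.le_succ i.2⟩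
    have hr : Measurable r := by fun_prop
    have hmul : ∀ X : Matrix (Fin n) (Fin n) ℝ, Measurable fun v => X *ᵥ g (r v) := fun X =>
      (show Continuous fun y : Fin n → ℝ => X *ᵥ y by fun_prop).measurable.comp (hg.comp hr)
    refine ⟨fun v => M *ᵥ g (r v) + v ⟨k, Finset.self_mem_range_succ k⟩ • (N *ᵥ g (r v)),
      (hmul M).add ((measurable_pi_apply _).smul (hmul N)), fun ω => ?_⟩
    simp only [state, h, r]

section Moments

variable {Ω : Type*} [MeasurableSpace Ω] {n : ℕ} {μ : Measure Ω} {w : ℕ → Ω → ℝ}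
  {M N : Matrix (Fin n) (Fin n) ℝ}

namespace IsNoise

lemma measurable_state (hw : IsNoise μ w) (z : Fin n → ℝ) (k : ℕ) :
    Measurable (state w M N z k) := by
  obtain ⟨g, hg, h⟩ := exists_state_eq_comp w M N z k
  rw [funext h]
  exact hg.comp (measurable_pi_lambda _ fun i => hw.measurable i)

/-- The state at time `k` is independent of the noise at time `k`. -/
lemma indepFun_state (hw : IsNoise μ w) (z : Fin n → ℝ) (k : ℕ) :
    IndepFun (w k) (state w M N z k) μ := by
  obtain ⟨g, hg, h⟩ := exists_state_eq_comp w M N z k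
  have h1 := hw.indep.indepFun_finset {k} (Finset.range k) (by simp) hw.measurable
  have hφ : Measurable fun v : ({k} : Finset ℕ) → ℝ => v ⟨k, Finset.mem_singleton_self k⟩ :=
    measurable_pi_apply _
  rw [funext h]
  exact h1.comp hφ hg

lemma integrable_sq (hw : IsNoise μ w) (k : ℕ) : Integrable (fun ω => w k ω ^ 2) μ :=
  (memLp_two_iff_integrable_sq (hw.measurable k).aestronglyMeasurable).1 (hw.memLp k)

lemma memLp_state [IsProbabilityMeasure μ] (hw : IsNoise μ w) (z : Fin n → ℝ) (k : ℕ) (i : Fin n) :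
    MemLp (fun ω => state w M N z k ω i) 2 μ := by
  induction k generalizing i with
  | zero => exact memLp_const _
  | succ k ih =>
    have hmul : ∀ (X : Matrix (Fin n) (Fin n) ℝ) i,
        MemLp (fun ω => (X *ᵥ state w M N z k ω) i) 2 μ := fun X i => by
      simp only [Matrix.mulVec, dotProduct]
      exact memLp_finsetSum _ fun j _ => (ih j).const_mul _
    have hcont : Continuous fun y : Fin n → ℝ => (N *ᵥ y) i := by fun_prop
    have hmeas := hcont.measurable.comp (hw.measurable_state (M := M) (N := N) z k)
    refine (hmul M i).add ?_
    change MemLp (fun ω => w k ω * (N *ᵥ state w M N z k ω) i) 2 μ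
    refine (memLp_two_iff_integrable_sq
      ((hw.measurable k).mul hmeas).aestronglyMeasurable).2 ?_
    change Integrable (fun ω => (w k ω * (N *ᵥ state w M N z k ω) i) ^ 2) μ
    simp only [mul_pow]
    -- The product of noise and state is square integrable because the squares are independent and
    -- integrable; no fourth moments enter.
    refine IndepFun.integrable_mul (X := fun ω => w k ω ^ 2)
      (Y := fun ω => (N *ᵥ state w M N z k ω) i ^ 2) ?_ (hw.integrable_sq k) ?_
    · exact (hw.indepFun_state z k).comp (φ := fun t : ℝ => t ^ 2)
        (ψ := fun y : Fin n → ℝ => (N *ᵥ y) i ^ 2) (by fun_prop) (hcont.pow 2).measurable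
    · exact (memLp_two_iff_integrable_sq hmeas.aestronglyMeasurable).1 (hmul N i)

lemma integrable_quad_state [IsProbabilityMeasure μ] (hw : IsNoise μ w)
    (G : Matrix (Fin n) (Fin n) ℝ) (z : Fin n → ℝ) (k : ℕ) :
    Integrable (fun ω => quad G (state w M N z k ω)) μ := by
  have e : ∀ ω, quad G (state w M N z k ω) =
      ∑ i, ∑ j, G i j * (state w M N z k ω i * state w M N z k ω j) := fun ω => by
    simp only [quad, dotProduct, Matrix.mulVec, Finset.mul_sum]
    exact Finset.sum_congr rfl fun i _ => Finset.sum_congr rfl fun j _ => by ring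
  simp only [e]
  exact integrable_finsetSum _ fun i _ => integrable_finsetSum _ fun j _ =>
    ((hw.memLp_state z k i).integrable_mul (hw.memLp_state z k j)).const_mul _

/-- Expand the square in w_k: by independence the cross term carries E w_k = 0 and the quadratic
term carries E w_k² = 1. -/
lemma integral_quad_state_succ [IsProbabilityMeasure μ] (hw : IsNoise μ w)
    (G : Matrix (Fin n) (Fin n) ℝ) (z : Fin n → ℝ) (k : ℕ) :
    ∫ ω, quad G (state w M N z (k + 1) ω) ∂μ = ∫ ω, quad (lyap M N G) (state w M N z k ω) ∂μ := by
  have e : ∀ ω, quad G (state w M N z (k + 1) ω) = quad (Mᵀ * G * M) (state w M N z k ω)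
      + w k ω * quad (Mᵀ * G * N + Nᵀ * G * M) (state w M N z k ω)
      + w k ω ^ 2 * quad (Nᵀ * G * N) (state w M N z k ω) := fun ω => by
    simp only [state, quad, Matrix.add_mulVec, Matrix.mul_assoc]
    simp only [← Matrix.mulVec_mulVec, Matrix.dotProduct_mulVec _ (Matrix.transpose _),
      Matrix.vecMul_transpose, Matrix.mulVec_add, Matrix.mulVec_smul, dotProduct_add,
      add_dotProduct, smul_dotProduct, dotProduct_smul, smul_eq_mul]
    ring
  have hind : ∀ X : Matrix (Fin n) (Fin n) ℝ,
      IndepFun (w k) (fun ω => quad X (state w M N z k ω)) μ := fun X =>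
    (hw.indepFun_state z k).comp (φ := id) measurable_id (continuous_quad X).measurable
  have hind2 : IndepFun (fun ω => w k ω ^ 2)
      (fun ω => quad (Nᵀ * G * N) (state w M N z k ω)) μ :=
    (hw.indepFun_state z k).comp (φ := fun t : ℝ => t ^ 2) (by fun_prop)
      (continuous_quad _).measurable
  have hint := fun X => hw.integrable_quad_state (M := M) (N := N) X z k
  have hw1 : Integrable (w k) μ := (hw.memLp k).integrable (by norm_num)
  have hw2 : ∫ ω, w k ω ^ 2 ∂μ = 1 := by simpa [sq] using hw.covariance k k
  have h1 : Integrable (fun ω => w k ω *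
      quad (Mᵀ * G * N + Nᵀ * G * M) (state w M N z k ω)) μ := (hind _).integrable_mul hw1 (hint _)
  have h2 : Integrable (fun ω => w k ω ^ 2 * quad (Nᵀ * G * N) (state w M N z k ω)) μ :=
    hind2.integrable_mul (hw.integrable_sq k) (hint _)
  have e1 := (hind (Mᵀ * G * N + Nᵀ * G * M)).integral_fun_mul_eq_mul_integral
    hw1.aestronglyMeasurable (hint _).aestronglyMeasurable
  have e2 := hind2.integral_fun_mul_eq_mul_integral
    (hw.integrable_sq k).aestronglyMeasurable (hint _).aestronglyMeasurable
  simp only [e]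
  rw [integral_add (by exact (hint _).add h1) h2, integral_add (hint _) h1, e1, e2, hw.mean_zero, hw2,
    zero_mul, add_zero, one_mul, ← integral_add (hint _) (hint _)]
  simp only [lyap_apply, quad_add]

/-- Second moments of the state are the iterates of the Lyapunov operator. -/
theorem integral_quad_state [IsProbabilityMeasure μ] (hw : IsNoise μ w)
    (G : Matrix (Fin n) (Fin n) ℝ) (z : Fin n → ℝ) (k : ℕ) :
    ∫ ω, quad G (state w M N z k ω) ∂μ = quad ((lyap M N ^ k) G) z := by
  induction k generalizing G with
  | zero => simp [state]
  | succ k ih => rw [hw.integral_quad_state_succ, ih, lyap_pow_succ_apply']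

lemma integral_state_dotProduct [IsProbabilityMeasure μ] (hw : IsNoise μ w) (z : Fin n → ℝ)
    (k : ℕ) : ∫ ω, state w M N z k ω ⬝ᵥ state w M N z k ω ∂μ = quad ((lyap M N ^ k) 1) z := by
  rw [← hw.integral_quad_state]
  simp only [quad_one]

lemma isASMS_iff [IsProbabilityMeasure μ] (hw : IsNoise μ w) :
    IsASMS μ w M N ↔ MeanSquareStable M N := by
  simp only [IsASMS, MeanSquareStable, hw.integral_state_dotProduct]

lemma ae_mulVec_state_eq_zero [IsProbabilityMeasure μ] (hw : IsNoise μ w)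
    {Q : Matrix (Fin n) (Fin n) ℝ} (hQ : Q.PosSemidef) {z : Fin n → ℝ} {k : ℕ}
    (h : quad ((lyap M N ^ k) Q) z = 0) : ∀ᵐ ω ∂μ, Q *ᵥ state w M N z k ω = 0 := by
  rw [← hw.integral_quad_state,
    integral_eq_zero_iff_of_nonneg (fun ω => quad_nonneg hQ _) (hw.integrable_quad_state Q z k)] at h
  filter_upwards [h] with ω hω using (quad_eq_zero_iff hQ).1 hω

lemma eq_zero_of_exactlyObservable [IsProbabilityMeasure μ] (hw : IsNoise μ w)
    {Q : Matrix (Fin n) (Fin n) ℝ} (hQ : Q.PosSemidef) (h : ExactlyObservable μ w M N Q)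
    (z : Fin n → ℝ) (hz : ∀ k, quad ((lyap M N ^ k) Q) z = 0) : z = 0 := by
  obtain ⟨T, -, hT⟩ := h
  exact hT z fun k _ => hw.ae_mulVec_state_eq_zero hQ (hz k)

/-- Joins the two alternatives: observability leaves only z = 0, whose trajectory is trivial. The
horizon T is absorbed by requiring vanishing at all times. -/
lemma tendsto_of_observable_or_detectable [IsProbabilityMeasure μ] (hw : IsNoise μ w)
    {Q : Matrix (Fin n) (Fin n) ℝ} (hQ : Q.PosSemidef)
    (h : ExactlyObservable μ w M N Q ∨ ExactlyDetectable μ w M N Q)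
    (z : Fin n → ℝ) (hz : ∀ k, quad ((lyap M N ^ k) Q) z = 0) :
    Tendsto (fun k => quad ((lyap M N ^ k) 1) z) atTop (𝓝 0) := by
  rcases h with h | ⟨T, -, hT⟩
  · rw [hw.eq_zero_of_exactlyObservable hQ h z hz]
    simp [quad]
  · simp only [← hw.integral_state_dotProduct (μ := μ)]
    exact hT z fun k _ => hw.ae_mulVec_state_eq_zero hQ (hz k)

end IsNoise

end Moments

/-! ### Policy evaluation and improvement -/

section Policy

variable {n m : ℕ} {A C : Matrix (Fin n) (Fin n) ℝ} {B D : Matrix (Fin n) (Fin m) ℝ}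
  {Q : Matrix (Fin n) (Fin n) ℝ} {R : Matrix (Fin m) (Fin m) ℝ}

/-- Deterministic form of exact detectability over an infinite horizon. -/
def DetectableForm (A C Q : Matrix (Fin n) (Fin n) ℝ) : Prop :=
  ∀ z, (∀ k, quad ((lyap A C ^ k) Q) z = 0) →
    Tendsto (fun k => quad ((lyap A C ^ k) 1) z) atTop (𝓝 0)

/-! ### Vanishing running cost: stability and definiteness -/

lemma posSemidef_conj {X : Matrix (Fin m) (Fin m) ℝ} (hX : X.PosSemidef)
    (F : Matrix (Fin m) (Fin n) ℝ) : (Fᵀ * X * F).PosSemidef := by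
  simpa using hX.conjTranspose_mul_mul_same F

lemma posDef_weight (hR : R.PosDef) {P : Matrix (Fin n) (Fin n) ℝ} (hP : P.PosSemidef) :
    (weight B D R P).PosDef :=
  (hR.add_posSemidef (posSemidef_conj hP B)).add_posSemidef (posSemidef_conj hP D)

/-- If the closed loop has vanishing running cost, the control vanishes and the closed loop
coincides with the uncontrolled system. -/
lemma closedLoop_eq_openLoop (hQ : Q.PosSemidef) (hR : R.PosDef) {F : Matrix (Fin m) (Fin n) ℝ}
    {z : Fin n → ℝ}
    (hz : ∀ k, quad ((lyap (A + B * F) (C + D * F) ^ k) (Q + Fᵀ * R * F)) z = 0) (k : ℕ)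
    (Y : Matrix (Fin n) (Fin n) ℝ) :
    quad ((lyap (A + B * F) (C + D * F) ^ k) Y) z = quad ((lyap A C ^ k) Y) z := by
  induction k generalizing z with
  | zero => simp
  | succ k ih =>
    have hW : (Q + Fᵀ * R * F).PosSemidef := hQ.add (posSemidef_conj hR.posSemidef F)
    have hF : F *ᵥ z = 0 := by
      have h0 := hz 0
      rw [pow_zero, Module.End.one_apply, quad_add, quad_conj] at h0
      by_contra hne
      have h1 : 0 < quad R (F *ᵥ z) := hR.dotProduct_mulVec_pos hne
      linarith [quad_nonneg hQ z]
    -- Since Fz = 0, the closed loop sends z to Az and Cz; the two costs are nonnegative with zero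
    -- sum, so both points inherit the hypothesis and the induction continues.
    have hsplit : ∀ j, quad ((lyap (A + B * F) (C + D * F) ^ j) (Q + Fᵀ * R * F)) (A *ᵥ z) = 0 ∧
        quad ((lyap (A + B * F) (C + D * F) ^ j) (Q + Fᵀ * R * F)) (C *ᵥ z) = 0 := fun j => by
      have h := hz (j + 1)
      rw [quad_lyap_pow_succ, Matrix.add_mulVec, Matrix.add_mulVec, ← Matrix.mulVec_mulVec,
        ← Matrix.mulVec_mulVec, hF, Matrix.mulVec_zero, Matrix.mulVec_zero, add_zero,
        add_zero] at h
      exact (add_eq_zero_iff_of_nonneg (quad_nonneg (posSemidef_lyap_pow hW j) _)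
        (quad_nonneg (posSemidef_lyap_pow hW j) _)).1 h
    rw [quad_lyap_pow_succ, quad_lyap_pow_succ, Matrix.add_mulVec, Matrix.add_mulVec,
      ← Matrix.mulVec_mulVec, ← Matrix.mulVec_mulVec, hF, Matrix.mulVec_zero, Matrix.mulVec_zero,
      add_zero, add_zero, ih fun j => (hsplit j).1, ih fun j => (hsplit j).2]

lemma quad_openLoop_eq_zero (hQ : Q.PosSemidef) (hR : R.PosDef) {F : Matrix (Fin m) (Fin n) ℝ}
    {z : Fin n → ℝ}
    (hz : ∀ k, quad ((lyap (A + B * F) (C + D * F) ^ k) (Q + Fᵀ * R * F)) z = 0) (k : ℕ) :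
    quad ((lyap A C ^ k) Q) z = 0 := by
  rw [← closedLoop_eq_openLoop hQ hR hz]
  have h := hz k
  rw [map_add, quad_add] at h
  exact ((add_eq_zero_iff_of_nonneg (quad_nonneg (posSemidef_lyap_pow hQ k) z)
    (quad_nonneg (posSemidef_lyap_pow (posSemidef_conj hR.posSemidef F) k) z)).1 h).1

/-- A gain admitting a positive semidefinite cost supersolution is stabilizing. -/
lemma stable_of_supersolution (hQ : Q.PosSemidef) (hR : R.PosDef) (hdet : DetectableForm A C Q)
    {F : Matrix (Fin m) (Fin n) ℝ} {P V : Matrix (Fin n) (Fin n) ℝ} (hP : P.PosSemidef)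
    (hV : V.PosSemidef) (e : P = lyap (A + B * F) (C + D * F) P + (Q + Fᵀ * R * F + V)) :
    MeanSquareStable (A + B * F) (C + D * F) := by
  have hW : (Q + Fᵀ * R * F).PosSemidef := hQ.add (posSemidef_conj hR.posSemidef F)
  refine meanSquareStable_of_detectable hP (hW.add hV) e fun z hz => ?_
  have hz' : ∀ k, quad ((lyap (A + B * F) (C + D * F) ^ k) (Q + Fᵀ * R * F)) z = 0 := fun k => by
    have h := hz k
    rw [map_add, quad_add] at h
    exact ((add_eq_zero_iff_of_nonneg (quad_nonneg (posSemidef_lyap_pow hW k) z)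
      (quad_nonneg (posSemidef_lyap_pow hV k) z)).1 h).1
  simp only [closedLoop_eq_openLoop hQ hR hz']
  exact hdet z (quad_openLoop_eq_zero hQ hR hz')

/-- Under observability the cost of any gain is positive definite. -/
lemma posDef_of_solvesEvaluation (hQ : Q.PosSemidef) (hR : R.PosDef)
    (hobs : ∀ z, (∀ k, quad ((lyap A C ^ k) Q) z = 0) → z = 0)
    {F : Matrix (Fin m) (Fin n) ℝ} {P : Matrix (Fin n) (Fin n) ℝ} (hP : P.PosSemidef)
    (e : SolvesEvaluation A C B D Q R F P) : P.PosDef := by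
  have hW : (Q + Fᵀ * R * F).PosSemidef := hQ.add (posSemidef_conj hR.posSemidef F)
  have e' : P = lyap (A + B * F) (C + D * F) P + (Q + Fᵀ * R * F) := by
    rw [← add_assoc]; exact e
  refine posDef_of_quad_eq_zero hP fun z hz => hobs z (quad_openLoop_eq_zero hQ hR (F := F)
    (B := B) (D := D) fun k => ?_)
  have hzero : ∀ k, quad ((lyap (A + B * F) (C + D * F) ^ k) P) z = 0 := fun k => by
    refine le_antisymm ?_ (quad_nonneg (posSemidef_lyap_pow hP k) z)
    have := (antitone_nat_of_succ_le (f := fun k => quad ((lyap (A + B * F) (C + D * F) ^ k) P) z)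
      fun k => quad_lyap_pow_succ_le hW e' k z) (Nat.zero_le k)
    simpa [hz] using this
  have h := hzero k
  rw [e', map_add, quad_add, ← lyap_pow_succ_apply', hzero, zero_add] at h
  exact h

/-! ### Completion of squares and the Riccati equation -/

lemma lyap_closedLoop_expand (F : Matrix (Fin m) (Fin n) ℝ) (P : Matrix (Fin n) (Fin n) ℝ) :
    lyap (A + B * F) (C + D * F) P + Q + Fᵀ * R * F =
      lyap A C P + Q + (Aᵀ * P * B + Cᵀ * P * D) * F + Fᵀ * (Bᵀ * P * A + Dᵀ * P * C)
        + Fᵀ * weight B D R P * F := by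
  simp only [lyap_apply, weight, Matrix.transpose_add, Matrix.transpose_mul, Matrix.mul_add,
    Matrix.add_mul, Matrix.mul_assoc]
  abel

/-- The normal equation for the minimizing gain; with its transpose it removes the inverse from the
later algebra. -/
lemma weight_mul_gain {P : Matrix (Fin n) (Fin n) ℝ} (hW : (weight B D R P).PosDef) :
    Bᵀ * P * A + Dᵀ * P * C = -(weight B D R P * gain A C B D R P) := by
  rw [gain, Matrix.mul_neg, neg_neg, Matrix.mul_nonsing_inv_cancel_left _ _
    ((Matrix.isUnit_iff_isUnit_det _).1 hW.isUnit)]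

lemma transpose_gain_mul_weight {P : Matrix (Fin n) (Fin n) ℝ} (hP : P.IsSymm)
    (hW : (weight B D R P).PosDef) :
    Aᵀ * P * B + Cᵀ * P * D = -((gain A C B D R P)ᵀ * weight B D R P) := by
  have h := congrArg Matrix.transpose (weight_mul_gain (A := A) (C := C) hW)
  simpa [Matrix.transpose_add, Matrix.transpose_mul, hP.eq,
    (Matrix.isHermitian_iff_isSymm.1 hW.1).eq, Matrix.mul_assoc] using h

/-- Completion of squares. -/
lemma lyap_closedLoop_eq {P : Matrix (Fin n) (Fin n) ℝ} (hP : P.IsSymm)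
    (hW : (weight B D R P).PosDef) (F : Matrix (Fin m) (Fin n) ℝ) :
    lyap (A + B * F) (C + D * F) P + Q + Fᵀ * R * F =
      lyap (A + B * gain A C B D R P) (C + D * gain A C B D R P) P + Q
        + (gain A C B D R P)ᵀ * R * gain A C B D R P
        + (F - gain A C B D R P)ᵀ * weight B D R P * (F - gain A C B D R P) := by
  rw [lyap_closedLoop_expand, lyap_closedLoop_expand, weight_mul_gain hW,
    transpose_gain_mul_weight hP hW]
  simp only [Matrix.transpose_sub, Matrix.mul_sub, Matrix.sub_mul, Matrix.mul_neg, Matrix.neg_mul,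
    Matrix.mul_assoc]
  abel

/-- The Riccati equation is the evaluation equation at the associated gain. -/
lemma solvesGARE_iff {P : Matrix (Fin n) (Fin n) ℝ}
    (hW : (weight B D R P).PosDef) :
    SolvesGARE A C B D Q R P ↔ SolvesEvaluation A C B D Q R (gain A C B D R P) P := by
  have e : Aᵀ * P * A + Cᵀ * P * C + Q
      - (Aᵀ * P * B + Cᵀ * P * D) * (weight B D R P)⁻¹ * (Bᵀ * P * A + Dᵀ * P * C) =
      lyap (A + B * gain A C B D R P) (C + D * gain A C B D R P) P + Q
        + (gain A C B D R P)ᵀ * R * gain A C B D R P := by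
    have h : (Aᵀ * P * B + Cᵀ * P * D) * (weight B D R P)⁻¹ * (Bᵀ * P * A + Dᵀ * P * C) =
        -((Aᵀ * P * B + Cᵀ * P * D) * gain A C B D R P) := by
      rw [gain, Matrix.mul_neg, neg_neg, Matrix.mul_assoc]
    rw [h, lyap_closedLoop_expand, weight_mul_gain hW, lyap_apply]
    simp only [Matrix.mul_neg, Matrix.mul_assoc]
    abel
  rw [SolvesGARE, e, SolvesEvaluation, eq_comm]
  rfl

/-- Policy improvement preserves stability. -/
lemma stable_gain (hQ : Q.PosSemidef) (hR : R.PosDef) (hdet : DetectableForm A C Q)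
    {F : Matrix (Fin m) (Fin n) ℝ} {P : Matrix (Fin n) (Fin n) ℝ} (hP : P.PosSemidef)
    (e : SolvesEvaluation A C B D Q R F P) :
    MeanSquareStable (A + B * gain A C B D R P) (C + D * gain A C B D R P) := by
  have hW : (weight B D R P).PosDef := posDef_weight hR hP
  refine stable_of_supersolution hQ hR hdet hP
    (posSemidef_conj hW.posSemidef (F - gain A C B D R P)) ?_
  rw [← add_assoc, ← add_assoc, ← lyap_closedLoop_eq (isSymm_of_posSemidef hP) hW]
  exact e

lemma posSemidef_of_solvesEvaluation (hQ : Q.PosSemidef) (hR : R.PosDef)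
    {F : Matrix (Fin m) (Fin n) ℝ} (hF : MeanSquareStable (A + B * F) (C + D * F))
    {P : Matrix (Fin n) (Fin n) ℝ} (hP : P.IsSymm) (e : SolvesEvaluation A C B D Q R F P) :
    P.PosSemidef :=
  hF.posSemidef hP (hQ.add (posSemidef_conj hR.posSemidef F)) (by rw [← add_assoc]; exact e)

lemma eq_of_solvesEvaluation {F : Matrix (Fin m) (Fin n) ℝ}
    (hF : MeanSquareStable (A + B * F) (C + D * F)) {P X : Matrix (Fin n) (Fin n) ℝ}
    (hP : P.IsSymm) (hX : X.IsSymm) (eP : SolvesEvaluation A C B D Q R F P)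
    (eX : SolvesEvaluation A C B D Q R F X) : P = X :=
  hF.unique (W := Q + Fᵀ * R * F) hP hX (by rw [← add_assoc]; exact eP)
    (by rw [← add_assoc]; exact eX)

/-- Policy improvement decreases the cost. -/
lemma posSemidef_sub_of_improvement (hR : R.PosDef)
    {F : Matrix (Fin m) (Fin n) ℝ} {P X : Matrix (Fin n) (Fin n) ℝ} (hP : P.PosSemidef)
    (eP : SolvesEvaluation A C B D Q R F P) (hX : X.IsSymm)
    (hG : MeanSquareStable (A + B * gain A C B D R P) (C + D * gain A C B D R P))
    (eX : SolvesEvaluation A C B D Q R (gain A C B D R P) X) : (P - X).PosSemidef := by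
  have hW : (weight B D R P).PosDef := posDef_weight hR hP
  have hPs := isSymm_of_posSemidef hP
  refine hG.posSemidef (hPs.sub hX) (posSemidef_conj hW.posSemidef (F - gain A C B D R P)) ?_
  have e1 : P = lyap (A + B * F) (C + D * F) P + Q + Fᵀ * R * F := eP
  rw [lyap_closedLoop_eq hPs hW] at e1
  have e2 : X = lyap (A + B * gain A C B D R P) (C + D * gain A C B D R P) X + Q
    + (gain A C B D R P)ᵀ * R * gain A C B D R P := eX
  refine (congrArg₂ (· - ·) e1 e2).trans ?_
  rw [map_sub]
  abel

/-- A positive semidefinite solution of the Riccati equation is a lower bound for the cost of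
every stabilizing gain. -/
lemma posSemidef_sub_of_solvesGARE (hR : R.PosDef) {F : Matrix (Fin m) (Fin n) ℝ}
    {P X : Matrix (Fin n) (Fin n) ℝ} (hF : MeanSquareStable (A + B * F) (C + D * F))
    (hP : P.IsSymm) (eP : SolvesEvaluation A C B D Q R F P) (hX : X.PosSemidef)
    (eX : SolvesGARE A C B D Q R X) : (P - X).PosSemidef := by
  have hW : (weight B D R X).PosDef := posDef_weight hR hX
  have hXs := isSymm_of_posSemidef hX
  -- By completion of squares at X, the difference P - X solves the Lyapunov equation at F with this
  -- square as source.
  refine hF.posSemidef (hP.sub hXs) (posSemidef_conj hW.posSemidef (F - gain A C B D R X)) ?_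
  have e1 : P = lyap (A + B * F) (C + D * F) P + Q + Fᵀ * R * F := eP
  have e2 : X = lyap (A + B * gain A C B D R X) (C + D * gain A C B D R X) X + Q
    + (gain A C B D R X)ᵀ * R * gain A C B D R X := (solvesGARE_iff hW).1 eX
  have e3 := lyap_closedLoop_eq (A := A) (C := C) (Q := Q) hXs hW F
  refine (congrArg₂ (· - ·) e1 (e2.trans (eq_sub_of_add_eq e3.symm))).trans ?_
  rw [map_sub]
  abel

/-- `stable_gain` does not ask the evaluated gain to be stabilizing, so it applies to the gain of X
itself. X is then the cost of a stabilizing gain and dominates Y; exchange the roles. -/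
lemma eq_of_solvesGARE (hQ : Q.PosSemidef) (hR : R.PosDef) (hdet : DetectableForm A C Q)
    {X Y : Matrix (Fin n) (Fin n) ℝ} (hX : X.PosSemidef) (hY : Y.PosSemidef)
    (eX : SolvesGARE A C B D Q R X) (eY : SolvesGARE A C B D Q R Y) : X = Y := by
  have key : ∀ {X Y : Matrix (Fin n) (Fin n) ℝ}, X.PosSemidef → Y.PosSemidef →
      SolvesGARE A C B D Q R X → SolvesGARE A C B D Q R Y → (X - Y).PosSemidef :=
    fun hX hY eX eY => by
      have e := (solvesGARE_iff (posDef_weight hR hX)).1 eX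
      exact posSemidef_sub_of_solvesGARE hR (stable_gain hQ hR hdet hX e)
        (isSymm_of_posSemidef hX) e hY eY
  refine eq_of_quad (isSymm_of_posSemidef hX) (isSymm_of_posSemidef hY) fun z => ?_
  have h1 := quad_nonneg (key hX hY eX eY) z
  have h2 := quad_nonneg (key hY hX eY eX) z
  rw [quad_sub] at h1 h2
  linarith

lemma exists_solvesEvaluation (hQ : Q.PosSemidef) (hR : R.PosDef)
    {F : Matrix (Fin m) (Fin n) ℝ} (hF : MeanSquareStable (A + B * F) (C + D * F)) :
    ∃ P : Matrix (Fin n) (Fin n) ℝ, P.IsSymm ∧ SolvesEvaluation A C B D Q R F P := by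
  obtain ⟨P, hP, e⟩ := hF.exists_solution
    (isSymm_of_posSemidef (hQ.add (posSemidef_conj hR.posSemidef F)))
  rw [← add_assoc] at e
  exact ⟨P, hP, e⟩

lemma exists_isPolicyIteration (hQ : Q.PosSemidef) (hR : R.PosDef) (hdet : DetectableForm A C Q)
    {F₀ : Matrix (Fin m) (Fin n) ℝ} (hF₀ : MeanSquareStable (A + B * F₀) (C + D * F₀)) :
    ∃ (P : ℕ → Matrix (Fin n) (Fin n) ℝ) (F : ℕ → Matrix (Fin m) (Fin n) ℝ),
      IsPolicyIteration A C B D Q R F₀ P F := by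
  -- Iterating on the subtype of stabilizing gains keeps every evaluation equation solvable.
  let S := {F : Matrix (Fin m) (Fin n) ℝ // MeanSquareStable (A + B * F) (C + D * F)}
  choose cost hsymm heval using fun F : S => exists_solvesEvaluation hQ hR F.2
  let next : S → S := fun F => ⟨gain A C B D R (cost F), stable_gain hQ hR hdet
    (posSemidef_of_solvesEvaluation hQ hR F.2 (hsymm F) (heval F)) (heval F)⟩
  exact ⟨fun i => cost (next^[i] ⟨F₀, hF₀⟩), fun i => (next^[i] ⟨F₀, hF₀⟩).1, rfl,
    fun i => hsymm _, fun i => heval _, fun i => by rw [Function.iterate_succ_apply']⟩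

lemma continuousAt_gain {P : Matrix (Fin n) (Fin n) ℝ} (hW : (weight B D R P).PosDef) :
    ContinuousAt (gain A C B D R) P := by
  have hdet : (weight B D R P).det ≠ 0 :=
    ((Matrix.isUnit_iff_isUnit_det _).1 hW.isUnit).ne_zero
  have hw : Continuous (weight B D R) := by unfold weight; fun_prop
  have hinv : ContinuousAt (fun X => (weight B D R X)⁻¹) P := by
    refine ContinuousAt.comp (g := Inv.inv) (continuousAt_matrix_inv _ ?_) hw.continuousAt
    rw [Ring.inverse_eq_inv']
    exact continuousAt_inv₀ hdet
  have hs : Continuous fun X : Matrix (Fin n) (Fin n) ℝ => Bᵀ * X * A + Dᵀ * X * C := by fun_prop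
  exact ((continuous_fst.matrix_mul continuous_snd).continuousAt.comp
    (hinv.prodMk hs.continuousAt)).neg

/-! ### Runs of the policy iteration and their limits -/

namespace IsPolicyIteration

variable {F₀ : Matrix (Fin m) (Fin n) ℝ} {P : ℕ → Matrix (Fin n) (Fin n) ℝ}
  {F : ℕ → Matrix (Fin m) (Fin n) ℝ}

lemma stable (h : IsPolicyIteration A C B D Q R F₀ P F) (hQ : Q.PosSemidef) (hR : R.PosDef)
    (hdet : DetectableForm A C Q) (hF₀ : MeanSquareStable (A + B * F₀) (C + D * F₀)) (i : ℕ) :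
    MeanSquareStable (A + B * F i) (C + D * F i) := by
  induction i with
  | zero => rwa [h.init]
  | succ i ih =>
    rw [h.update]
    exact stable_gain hQ hR hdet
      (posSemidef_of_solvesEvaluation hQ hR ih (h.symm i) (h.evaluation i)) (h.evaluation i)

lemma posSemidef (h : IsPolicyIteration A C B D Q R F₀ P F) (hQ : Q.PosSemidef) (hR : R.PosDef)
    (hdet : DetectableForm A C Q) (hF₀ : MeanSquareStable (A + B * F₀) (C + D * F₀)) (i : ℕ) :
    (P i).PosSemidef :=
  posSemidef_of_solvesEvaluation hQ hR (h.stable hQ hR hdet hF₀ i) (h.symm i) (h.evaluation i)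

lemma antitone (h : IsPolicyIteration A C B D Q R F₀ P F) (hQ : Q.PosSemidef) (hR : R.PosDef)
    (hdet : DetectableForm A C Q) (hF₀ : MeanSquareStable (A + B * F₀) (C + D * F₀)) (i : ℕ) :
    (P i - P (i + 1)).PosSemidef := by
  have h1 := h.stable hQ hR hdet hF₀ (i + 1)
  have h2 := h.evaluation (i + 1)
  rw [h.update] at h1 h2
  exact posSemidef_sub_of_improvement hR (h.posSemidef hQ hR hdet hF₀ i) (h.evaluation i)
    (h.symm _) h1 h2

/-- The costs of a policy iteration converge to a solution of the Riccati equation. -/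
lemma exists_limit (h : IsPolicyIteration A C B D Q R F₀ P F) (hQ : Q.PosSemidef) (hR : R.PosDef)
    (hdet : DetectableForm A C Q) (hF₀ : MeanSquareStable (A + B * F₀) (C + D * F₀)) :
    ∃ X : Matrix (Fin n) (Fin n) ℝ, X.PosSemidef ∧ SolvesGARE A C B D Q R X ∧
      Tendsto P atTop (𝓝 X) ∧ Tendsto F atTop (𝓝 (gain A C B D R X)) := by
  obtain ⟨X, hX, hlim, -⟩ := exists_tendsto_of_antitone (h.posSemidef hQ hR hdet hF₀)
    (h.antitone hQ hR hdet hF₀)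
  have hW : (weight B D R X).PosDef := posDef_weight hR hX
  have hF : Tendsto F atTop (𝓝 (gain A C B D R X)) := by
    -- The initial gain is arbitrary; only from index 1 on are the gains functions of the costs.
    refine (tendsto_add_atTop_iff_nat 1).1 ?_
    simp only [h.update]
    exact (continuousAt_gain hW).tendsto.comp hlim
  refine ⟨X, hX, (solvesGARE_iff hW).2 ?_, hlim, hF⟩
  have hc : Continuous fun p : Matrix (Fin n) (Fin n) ℝ × Matrix (Fin m) (Fin n) ℝ =>
      (A + B * p.2)ᵀ * p.1 * (A + B * p.2) + (C + D * p.2)ᵀ * p.1 * (C + D * p.2) + Q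
        + p.2ᵀ * R * p.2 := by fun_prop
  refine tendsto_nhds_unique hlim ((((hc.tendsto (X, gain A C B D R X)).comp
    (hlim.prodMk_nhds hF))).congr fun i => ?_)
  exact (h.evaluation i).symm

end IsPolicyIteration

end Policy

end SLQR

/-- Convergence of the off-line policy iteration for the stochastic LQ regulator. -/
theorem mainTheorem1 {Ω : Type*} [MeasurableSpace Ω] (μ : Measure Ω) [IsProbabilityMeasure μ]
    (w : ℕ → Ω → ℝ) (hw : SLQR.IsNoise μ w) {n m : ℕ}
    (A C : Matrix (Fin n) (Fin n) ℝ) (B D : Matrix (Fin n) (Fin m) ℝ)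
    (Q : Matrix (Fin n) (Fin n) ℝ) (R : Matrix (Fin m) (Fin m) ℝ)
    (hA : SLQR.StandingAssumption μ w A C B D Q R)
    (F₀ : Matrix (Fin m) (Fin n) ℝ) (hF₀ : SLQR.IsStabilizing μ w A C B D F₀) :
    (∃ (P : ℕ → Matrix (Fin n) (Fin n) ℝ) (F : ℕ → Matrix (Fin m) (Fin n) ℝ),
      SLQR.IsPolicyIteration A C B D Q R F₀ P F) ∧
    ∃ Pstar : Matrix (Fin n) (Fin n) ℝ,
      -- `Pstar` is the unique positive semidefinite solution of the GARE
      Pstar.PosSemidef ∧ SLQR.SolvesGARE A C B D Q R Pstar ∧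
      (∀ X : Matrix (Fin n) (Fin n) ℝ,
        X.PosSemidef → SLQR.SolvesGARE A C B D Q R X → X = Pstar) ∧
      (SLQR.ExactlyObservable μ w A C Q → Pstar.PosDef) ∧
      ∀ (P : ℕ → Matrix (Fin n) (Fin n) ℝ) (F : ℕ → Matrix (Fin m) (Fin n) ℝ),
        SLQR.IsPolicyIteration A C B D Q R F₀ P F →
        (∀ i,
          -- every gain is stabilizing
          SLQR.IsStabilizing μ w A C B D (F i) ∧
          -- every step is well defined
          (∀ X : Matrix (Fin n) (Fin n) ℝ,
            X.IsSymm → SLQR.SolvesEvaluation A C B D Q R (F i) X → X = P i) ∧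
          (SLQR.weight B D R (P i)).PosDef ∧
          (P i).PosSemidef ∧
          (SLQR.ExactlyObservable μ w A C Q → (P i).PosDef) ∧
          -- monotonicity
          (P i - P (i + 1)).PosSemidef ∧
          (P (i + 1) - Pstar).PosSemidef) ∧
        -- convergence
        Tendsto P atTop (𝓝 Pstar) ∧
        Tendsto F atTop (𝓝 (SLQR.gain A C B D R Pstar)) := by
  have hQ := hA.posSemidef_Q
  have hR := hA.posDef_R
  have hdet : SLQR.DetectableForm A C Q :=
    hw.tendsto_of_observable_or_detectable hQ hA.observable_or_detectable
  have hF₀' := hw.isASMS_iff.1 hF₀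
  -- One auxiliary run produces the Riccati solution; the limit of any other run is identified with
  -- it by uniqueness.
  obtain ⟨P₀, G₀, h₀⟩ := SLQR.exists_isPolicyIteration hQ hR hdet hF₀'
  obtain ⟨X, hX, eX, -, -⟩ := h₀.exists_limit hQ hR hdet hF₀'
  refine ⟨⟨P₀, G₀, h₀⟩, X, hX, eX, fun Y hY eY => SLQR.eq_of_solvesGARE hQ hR hdet hY hX eY eX,
    fun hobs => SLQR.posDef_of_solvesEvaluation hQ hR (hw.eq_zero_of_exactlyObservable hQ hobs) hX
      ((SLQR.solvesGARE_iff (SLQR.posDef_weight hR hX)).1 eX),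
    fun P F h => ⟨fun i => ?_, ?_⟩⟩
  · have hs := h.stable hQ hR hdet hF₀'
    have hp := h.posSemidef hQ hR hdet hF₀' i
    exact ⟨hw.isASMS_iff.2 (hs i),
      fun Y hY eY => SLQR.eq_of_solvesEvaluation (hs i) hY (h.symm i) eY (h.evaluation i),
      SLQR.posDef_weight hR hp, hp,
      fun hobs => SLQR.posDef_of_solvesEvaluation hQ hR (hw.eq_zero_of_exactlyObservable hQ hobs)
        hp (h.evaluation i),
      h.antitone hQ hR hdet hF₀' i,
      SLQR.posSemidef_sub_of_solvesGARE hR (hs (i + 1)) (h.symm _) (h.evaluation _) hX eX⟩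
  · obtain ⟨Y, hY, eY, hlim, hlimF⟩ := h.exists_limit hQ hR hdet hF₀'
    obtain rfl := SLQR.eq_of_solvesGARE hQ hR hdet hY hX eY eX
    exact ⟨hlim, hlimF⟩
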